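/- Let $\|\cdot\|$ be an arbitrary norm on $\mathbb{R}^n$ and let $$f(x,u)=Q(x,x,u)+L(x,u)+K(u),\qquad x\in\mathbb{R}^n,\ u\in\mathbb{R}^k,$$ take values in $\mathbb{R}^n$, where $Q(x,y,u)$ is bilinear in $(x,y)$, $L(x,u)$ is linear in $x$, and $Q$, $L$, $K$ depend affinely (for instance linearly) on $u$. Write $J(x,u;y)=\frac{\partial f}{\partial x}\big|_{(x,u)}y=Q(x,y,u)+Q(y,x,u)+L(y,u)$ for the Jacobian, which is $2Q(x,y,u)+L(y,u)$ when $Q$ is symmetric in $(x,y)$. Let $(x^\star,u^\star)$ satisfy $f(x^\star,u^\star)=0$, put $J_\star(u;y)=J(x^\star,u;y)$ and $J_{\star\star}y=J(x^\star,u^\star;y)$, and suppose that $J_{\star\star}$ is invertible. Define $$e(u-u^\star)=\big\|J_{\star\star}^{-1}\big(f(x^\star,u)-f(x^\star,u^\star)\big)\big\|,\qquad h(u)=\max_{\|y\|\le 1}\big\|J_{\star\star}^{-1}Q(y,y,u)\big\|,\qquad g(u-u^\star)=\max_{\|y\|\le 1}\big\|J_{\star\star}^{-1}J_\star(u;y)-y\big\|.$$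 (1) For every $r>0$ and every $u$ with $r\,h(u)+g(u-u^\star)+\frac1r e(u-u^\star)\le 1$ there is an $x$ with $f(x,u)=0$ and $\|x-x^\star\|\le r$. For $r>0$ and $\delta\in(0,1]$ let $$\mathcal U_r(\delta)=\Big\{u: r\delta\,h(u)+g(u-u^\star)+\tfrac{1}{r\delta}e(u-u^\star)\le 1\Big\},\qquad \mathcal U_r=\bigcup_{0<\delta\le1}\mathcal U_r(\delta),$$ $$\mathcal U_\infty=\Big\{u: 2\sqrt{h(u)\,e(u-u^\star)}+g(u-u^\star)\le 1\Big\}.$$ (2) For every $r>0$ and every $u\in\mathcal U_r$ there is an $x$ with $f(x,u)=0$ and $\|x-x^\star\|\le r$. (3) For all $r>0$ and $\delta\in(0,1]$ the set $\mathcal U_r(\delta)$ is convex (so $\mathcal U_r$ is a union of convex sets), and $u^\star$ lies in the interior of $\mathcal U_r$ for every $r>0$. (4) The union $\bigcup_{r>0}\mathcal U_r$ equals $\mathcal U_\infty$ up to degenerate boundary points: it is the set of all $u\in\mathcal U_\infty$ except those with $g(u-u^\star)=1$ for which exactly one of $h(u)$, $e(u-u^\star)$ is zero. If $r=0$ is admitted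 as well, with $\mathcal U_0=\{u: e(u-u^\star)=0,\ g(u-u^\star)\le1\}$ (the convention $0/0=0$ and $c/0=\infty$ for $c>0$), then the only points of $\mathcal U_\infty$ missing from the union are those with $g(u-u^\star)=1$, $h(u)=0$, $e(u-u^\star)\ne0$. (5) For every $u\in\mathcal U_\infty$, except those with $g(u-u^\star)=1$, $h(u)=0$, $e(u-u^\star)\neq0$, there is an $x$ with $f(x,u)=0$. -/

import Mathlib

/-- A system of equations `f(x, u) = Q(x, x, u) + L(x, u) + K(u) = 0`, quadratic in the unknown `x`
and affine in the parameter `u`: `Q(·, ·, u)` is bilinear, `L(·, u)` is linear, and `Q`, `L`, `K`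
depend affinely (in particular possibly linearly) on `u`. -/
structure QuadSystem (E P : Type*) [NormedAddCommGroup E] [NormedSpace ℝ E]
    [NormedAddCommGroup P] [NormedSpace ℝ P] where
  /-- the quadratic terms -/
  Q : P →ᵃ[ℝ] (E →ₗ[ℝ] E →ₗ[ℝ] E)
  /-- the linear terms -/
  L : P →ᵃ[ℝ] (E →ₗ[ℝ] E)
  /-- the constant terms -/
  K : P →ᵃ[ℝ] E

namespace QuadSystem

variable {E P : Type*} [NormedAddCommGroup E] [NormedSpace ℝ E]
  [NormedAddCommGroup P] [NormedSpace ℝ P]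

/-- `f(x, u) = Q(x, x, u) + L(x, u) + K(u)`. -/
def f (S : QuadSystem E P) (x : E) (u : P) : E := S.Q u x x + S.L u x + S.K u

/-- The Jacobian `∂f/∂x` at `(x, u)`, as the linear map `y ↦ Q(x, y, u) + Q(y, x, u) + L(y, u)`. -/
def jac (S : QuadSystem E P) (x : E) (u : P) : Module.End ℝ E :=
  S.Q u x + (S.Q u).flip x + S.L u

/-- For symmetric `Q(·, ·, u)` the Jacobian is `y ↦ 2 Q(x, y, u) + L(y, u)`. -/
theorem jac_of_symm (S : QuadSystem E P) (x : E) (u : P)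
    (hQ : ∀ y z, S.Q u y z = S.Q u z y) (y : E) :
    S.jac x u y = (2 : ℝ) • S.Q u x y + S.L u y := by
  simp [jac, hQ y x, two_smul]

/-- `jac` is the Fréchet derivative of `f` with respect to `x`. -/
theorem hasFDerivAt_f [FiniteDimensional ℝ E] (S : QuadSystem E P) (x : E) (u : P) :
    HasFDerivAt (fun x => S.f x u) (LinearMap.toContinuousLinearMap (S.jac x u)) x := by
  let B : E →L[ℝ] E →L[ℝ] E := LinearMap.toContinuousLinearMap
    ((LinearMap.toContinuousLinearMap (𝕜 := ℝ) (E := E) (F' := E)).toLinearMap ∘ₗ S.Q u)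
  have h1 : HasFDerivAt (fun x => B x x) _ x :=
    B.hasFDerivAt_of_bilinear (hasFDerivAt_id x) (hasFDerivAt_id x)
  have h2 := (LinearMap.toContinuousLinearMap (S.L u)).hasFDerivAt (x := x)
  refine ((h1.add h2).add_const (S.K u)).congr_fderiv ?_
  ext y
  simp [B, jac]

/-- The inverse `J_{⋆⋆}⁻¹` of the Jacobian at the nominal point `(xs, us)`
(meaningful when that Jacobian is invertible). -/
noncomputable def jacInv (S : QuadSystem E P) (xs : E) (us : P) : Module.End ℝ E :=
  Ring.inverse (S.jac xs us)

/-- `e(u - u⋆) = ‖J_{⋆⋆}⁻¹ (f(x⋆, u) - f(x⋆, u⋆))‖`, as a function of `u`. -/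
noncomputable def e (S : QuadSystem E P) (xs : E) (us u : P) : ℝ :=
  ‖S.jacInv xs us (S.f xs u - S.f xs us)‖

/-- `h(u) = max_{‖y‖ ≤ 1} ‖J_{⋆⋆}⁻¹ Q(y, y, u)‖`. -/
noncomputable def h (S : QuadSystem E P) (xs : E) (us u : P) : ℝ :=
  sSup ((fun y => ‖S.jacInv xs us (S.Q u y y)‖) '' Metric.closedBall (0 : E) 1)

/-- `g(u - u⋆) = max_{‖y‖ ≤ 1} ‖J_{⋆⋆}⁻¹ J_⋆(u; y) - y‖`, as a function of `u`, where `J_⋆(u; ·)` is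
the Jacobian at `(x⋆, u)`. -/
noncomputable def g (S : QuadSystem E P) (xs : E) (us u : P) : ℝ :=
  sSup ((fun y => ‖S.jacInv xs us (S.jac xs u y) - y‖) '' Metric.closedBall (0 : E) 1)

/-- The supremum defining `h` is attained. -/
theorem h_isGreatest [FiniteDimensional ℝ E] (S : QuadSystem E P) (xs : E) (us u : P) :
    IsGreatest ((fun y => ‖S.jacInv xs us (S.Q u y y)‖) '' Metric.closedBall (0 : E) 1)
      (S.h xs us u) := by
  have : ProperSpace E := FiniteDimensional.proper ℝ E
  let B : E →L[ℝ] E →L[ℝ] E := LinearMap.toContinuousLinearMap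
    ((LinearMap.toContinuousLinearMap (𝕜 := ℝ) (E := E) (F' := E)).toLinearMap ∘ₗ S.Q u)
  have hB : Continuous (fun y => S.Q u y y) :=
    (B.continuous.clm_apply continuous_id : Continuous fun y => B y y)
  have hc : Continuous (fun y => ‖S.jacInv xs us (S.Q u y y)‖) :=
    ((S.jacInv xs us).continuous_of_finiteDimensional.comp hB).norm
  exact ((isCompact_closedBall (0 : E) 1).image hc).isGreatest_sSup
    ((Metric.nonempty_closedBall.2 zero_le_one).image _)

/-- The supremum defining `g` is attained. -/
theorem g_isGreatest [FiniteDimensional ℝ E] (S : QuadSystem E P) (xs : E) (us u : P) :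
    IsGreatest ((fun y => ‖S.jacInv xs us (S.jac xs u y) - y‖) '' Metric.closedBall (0 : E) 1)
      (S.g xs us u) := by
  have : ProperSpace E := FiniteDimensional.proper ℝ E
  have hc : Continuous (fun y => ‖S.jacInv xs us (S.jac xs u y) - y‖) :=
    (((S.jacInv xs us).continuous_of_finiteDimensional.comp
      (S.jac xs u).continuous_of_finiteDimensional).sub continuous_id).norm
  exact ((isCompact_closedBall (0 : E) 1).image hc).isGreatest_sSup
    ((Metric.nonempty_closedBall.2 zero_le_one).image _)

/-- `U_r(δ) = {u : r δ h(u) + g(u - u⋆) + e(u - u⋆) / (r δ) ≤ 1}`, used for `r, δ > 0`. -/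
def certSet (S : QuadSystem E P) (xs : E) (us : P) (r δ : ℝ) : Set P :=
  {u | r * δ * S.h xs us u + S.g xs us u + 1 / (r * δ) * S.e xs us u ≤ 1}

/-- `U_r = ⋃_{0 < δ ≤ 1} U_r(δ)`, used for `r > 0`. -/
def certUnion (S : QuadSystem E P) (xs : E) (us : P) (r : ℝ) : Set P :=
  ⋃ δ ∈ Set.Ioc (0 : ℝ) 1, S.certSet xs us r δ

/-- `U_∞ = {u : 2 √(h(u) e(u - u⋆)) + g(u - u⋆) ≤ 1}`. -/
def certInf (S : QuadSystem E P) (xs : E) (us : P) : Set P :=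
  {u | 2 * √(S.h xs us u * S.e xs us u) + S.g xs us u ≤ 1}

end QuadSystem

/-! Solutions near `xs` come from the Newton-type map `d ↦ d - J⁻¹ f(xs + d, u)` with the Jacobian
frozen at `(xs, us)`. As `f` is quadratic in `x`, its expansion at `xs` is exact (`f_add`), so on
`‖d‖ ≤ r` the image has norm at most `e + g r + h r²`. The certificate says exactly that this is at
most `r`; Brouwer's theorem for the given norm then yields a fixed point, which is a zero of `f`
since `J⁻¹` is injective (`exists_solution_of_certificate`).

Brouwer is proved by the Milnor–Rogers argument: for a smooth retraction `r` onto the sphere, the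
volume of the image of the ball under `x + t (r x - x)` is polynomial in `t` and constant for small
`t`, yet the same integral vanishes at `t = 1`.

Convexity holds because `h`, `g`, `e` are suprema of norms of affine functions of `u`. In the
unions, `r` and `δ` enter only through `s = r δ`; minimising `s h + e / s` over `s > 0` gives `2 √(h
e)`, and the exceptional points are those where the infimum is needed but not attained. -/

/-! ### Determinant integrals and the absence of a smooth retraction -/

open MeasureTheory Metric Set Polynomial in
/-- `t ↦ det (1 + t A)` is a polynomial in `t`, of degree at most the dimension. -/
theorem exists_polynomial_eval_det_one_add_smul {E : Type*} [NormedAddCommGroup E]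
    [NormedSpace ℝ E] [FiniteDimensional ℝ E] (A : E →L[ℝ] E) :
    ∃ p : ℝ[X], p.natDegree ≤ Module.finrank ℝ E ∧
      ∀ t : ℝ, p.eval t = (ContinuousLinearMap.id ℝ E + t • A).det := by
  let b := Module.finBasis ℝ E
  let M := LinearMap.toMatrix b b (A : E →ₗ[ℝ] E)
  refine ⟨Matrix.det ((X : ℝ[X]) • M.map C + (1 : Matrix _ _ ℝ).map C), ?_, fun t => ?_⟩
  · simpa using natDegree_det_X_add_C_le M 1
  · have h1 : (ContinuousLinearMap.id ℝ E + t • A).det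
        = LinearMap.det (LinearMap.id + t • (A : E →ₗ[ℝ] E)) := rfl
    rw [h1, ← LinearMap.det_toMatrix b, ← Polynomial.coe_evalRingHom, RingHom.map_det]
    congr 1
    ext i j
    by_cases hij : i = j <;> simp [M, hij] <;> ring

open MeasureTheory Metric Set Polynomial in
/-- If `∫ det (1 + t A x)` takes the same value `c` for all small `t > 0`,
it takes this value for `t = 1`. -/
theorem integral_det_one_add_eq_of_forall_small {E : Type*} [NormedAddCommGroup E]
    [NormedSpace ℝ E] [FiniteDimensional ℝ E] [MeasurableSpace E] {μ : Measure E} (A : E → E →L[ℝ] E)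
    {c ε : ℝ} (hε : 0 < ε)
    (hint : ∀ t : ℝ, Integrable (fun x => (ContinuousLinearMap.id ℝ E + t • A x).det) μ)
    (hc : ∀ t ∈ Ioo 0 ε, ∫ x, (ContinuousLinearMap.id ℝ E + t • A x).det ∂μ = c) :
    ∫ x, (ContinuousLinearMap.id ℝ E + A x).det ∂μ = c := by
  choose p hdeg hp using fun x => exists_polynomial_eval_det_one_add_smul (A x)
  obtain ⟨s, hsub, hcard⟩ :=
    (Ioo_infinite hε).exists_subset_card_eq (Module.finrank ℝ E + 1)
  have hinj : Set.InjOn (id : ℝ → ℝ) s := Function.injective_id.injOn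
  -- Lagrange interpolation at `finrank + 1` nodes in `(0, ε)`: the weights do not depend on `x`, so
  -- they come out of the integral, and they sum to 1.
  have key : ∀ x, (ContinuousLinearMap.id ℝ E + A x).det
      = ∑ t ∈ s, (Lagrange.basis s id t).eval 1 * (ContinuousLinearMap.id ℝ E + t • A x).det := by
    intro x
    have h1 : (p x).degree < s.card := by
      rw [hcard]
      exact (degree_le_natDegree).trans_lt (by exact_mod_cast Nat.lt_succ_of_le (hdeg x))
    have h2 := congrArg (eval 1) (Lagrange.eq_interpolate hinj h1)
    rw [hp, one_smul] at h2
    rw [h2, Lagrange.interpolate_apply, eval_finsetSum]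
    exact Finset.sum_congr rfl fun t _ => by simp [hp, mul_comm]
  have hne : s.Nonempty := Finset.card_pos.1 (by omega)
  have hsum := congrArg (eval 1) (Lagrange.sum_basis hinj hne)
  rw [eval_finsetSum, eval_one] at hsum
  simp_rw [key]
  rw [integral_finsetSum _ fun t _ => (hint t).const_mul _]
  calc _ = ∑ t ∈ s, (Lagrange.basis s id t).eval 1 * c :=
        Finset.sum_congr rfl fun t ht => by rw [integral_const_mul, hc t (hsub ht)]
    _ = c := by rw [← Finset.sum_mul, hsum, one_mul]

open Metric Set in
/-- A Lipschitz function on the closed unit ball that vanishes on the unit sphere stays Lipschitz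
when extended by zero. -/
theorem LipschitzOnWith.lipschitzWith_indicator_closedBall {E F : Type*} [NormedAddCommGroup E]
    [NormedSpace ℝ E] [NormedAddCommGroup F] {v : E → F} {K : NNReal}
    (hv : LipschitzOnWith K v (closedBall 0 1)) (h0 : ∀ x, ‖x‖ = 1 → v x = 0) :
    LipschitzWith K ((closedBall (0 : E) 1).indicator v) := by
  -- Compare `x` with its radial projection to the sphere, where `v` vanishes, at distance `1 - ‖x‖
  -- ≤ ‖x - z‖`. For `x = 0` the direction of `z` is used.
  have key : ∀ x z : E, ‖x‖ ≤ 1 → 1 < ‖z‖ → ‖v x‖ ≤ K * ‖x - z‖ := by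
    intro x z hx hz
    have hb : ‖v x‖ ≤ K * (1 - ‖x‖) := by
      rcases eq_or_ne x 0 with rfl | hx0
      · have hz1 : ‖(‖z‖⁻¹ : ℝ) • z‖ = 1 := by
          rw [norm_smul, norm_inv, norm_norm, inv_mul_cancel₀ (by positivity)]
        have := hv.dist_le_mul 0 (by simp) (‖z‖⁻¹ • z) (by simp [hz1])
        rw [dist_eq_norm, dist_eq_norm, h0 _ hz1, sub_zero, zero_sub, norm_neg, hz1] at this
        simpa using this
      · have hx1 : ‖(‖x‖⁻¹ : ℝ) • x‖ = 1 := by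
          rw [norm_smul, norm_inv, norm_norm, inv_mul_cancel₀ (norm_ne_zero_iff.2 hx0)]
        have := hv.dist_le_mul x (by simpa using hx) (‖x‖⁻¹ • x) (by simp [hx1])
        rw [dist_eq_norm, dist_eq_norm, h0 _ hx1, sub_zero] at this
        refine this.trans (mul_le_mul_of_nonneg_left ?_ K.2)
        have hx' : 0 < ‖x‖ := norm_pos_iff.2 hx0
        have h3 : x - ‖x‖⁻¹ • x = (1 - ‖x‖⁻¹) • x := by rw [sub_smul, one_smul]
        have h4 : 1 ≤ ‖x‖⁻¹ := (one_le_inv₀ hx').2 hx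
        rw [h3, norm_smul, Real.norm_eq_abs, abs_of_nonpos (by linarith), neg_sub, sub_mul,
          inv_mul_cancel₀ hx'.ne', one_mul]
    refine hb.trans (mul_le_mul_of_nonneg_left ?_ K.2)
    have := norm_sub_norm_le z x
    rw [norm_sub_rev] at this
    linarith
  refine LipschitzWith.of_dist_le_mul fun x z => ?_
  by_cases hx : ‖x‖ ≤ 1 <;> by_cases hz : ‖z‖ ≤ 1
  · rw [indicator_of_mem (by simpa using hx), indicator_of_mem (by simpa using hz)]
    exact hv.dist_le_mul x (by simpa using hx) z (by simpa using hz)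
  · rw [indicator_of_mem (by simpa using hx), indicator_of_notMem (by simpa using hz),
      dist_eq_norm, dist_eq_norm, sub_zero]
    exact key x z hx (not_le.1 hz)
  · rw [indicator_of_notMem (by simpa using hx), indicator_of_mem (by simpa using hz),
      dist_comm, dist_comm x, dist_eq_norm, dist_eq_norm, sub_zero]
    exact key z x hz (not_le.1 hx)
  · rw [indicator_of_notMem (by simpa using hx), indicator_of_notMem (by simpa using hz), dist_self]
    positivity

/-- A perturbation of the identity by a contraction is bijective. -/
theorem LipschitzWith.bijective_id_add {E : Type*} [NormedAddCommGroup E] [CompleteSpace E]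
    {w : E → E} {K : NNReal} (hK : K < 1) (hw : LipschitzWith K w) :
    Function.Bijective fun x => x + w x := by
  constructor
  · intro x y hxy
    have h1 : x - y = w y - w x := by
      simp only at hxy
      rw [sub_eq_sub_iff_add_eq_add, hxy, add_comm]
    have h2 := hw.dist_le_mul y x
    rw [dist_eq_norm, dist_eq_norm, ← h1, norm_sub_rev y x] at h2
    have hK' : (K : ℝ) < 1 := by exact_mod_cast hK
    have h3 : ‖x - y‖ ≤ 0 := by nlinarith [norm_nonneg (x - y)]
    exact sub_eq_zero.1 (norm_le_zero_iff.1 h3)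
  · intro y
    have hc : ContractingWith K fun x => y - w x :=
      ⟨hK, LipschitzWith.of_dist_le_mul fun a b => by
        rw [dist_eq_norm, sub_sub_sub_cancel_left, ← dist_eq_norm, dist_comm]
        exact hw.dist_le_mul a b⟩
    refine ⟨hc.fixedPoint, ?_⟩
    have h4 : y - w hc.fixedPoint = hc.fixedPoint := hc.fixedPoint_isFixedPt
    exact (sub_eq_iff_eq_add.1 h4).symm

open Metric Set Filter Topology in
/-- Moving the unit ball along a Lipschitz field `v` that vanishes on the sphere and keeps the ball
inside itself maps the open ball bijectively to itself. -/
theorem LipschitzOnWith.bijOn_ball_add_smul {E : Type*} [NormedAddCommGroup E] [NormedSpace ℝ E]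
    [CompleteSpace E] {v : E → E} {K : NNReal} (hv : LipschitzOnWith K v (closedBall 0 1))
    (h0 : ∀ x, ‖x‖ = 1 → v x = 0) {t : ℝ} (ht : 0 ≤ t) (htK : t * K < 1)
    (hmaps : ∀ x, ‖x‖ ≤ 1 → ‖x + t • v x‖ ≤ 1) :
    BijOn (fun x => x + t • v x) (ball 0 1) (ball 0 1) := by
  -- The extended map is a bijection of `E` fixing every point of norm at least 1. Injectivity keeps
  -- interior points off the sphere, and preimages of interior points must be interior.
  set w : E → E := fun x => t • (closedBall (0 : E) 1).indicator v x with hw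
  have hlip : LipschitzWith (t.toNNReal * K) w := by
    refine LipschitzWith.of_dist_le_mul fun x y => ?_
    rw [dist_smul₀, Real.norm_of_nonneg ht, NNReal.coe_mul, Real.coe_toNNReal t ht, mul_assoc]
    exact mul_le_mul_of_nonneg_left
      ((hv.lipschitzWith_indicator_closedBall h0).dist_le_mul x y) ht
  have hbij := hlip.bijective_id_add (by
    rw [← NNReal.coe_lt_coe, NNReal.coe_mul, Real.coe_toNNReal t ht]; simpa using htK)
  have hin : ∀ x, ‖x‖ ≤ 1 → x + w x = x + t • v x := fun x hx => by
    simp only [hw]; rw [indicator_of_mem (by simpa using hx)]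
  have hout : ∀ x, 1 ≤ ‖x‖ → x + w x = x := by
    intro x hx
    rcases hx.eq_or_lt with h | h
    · rw [hin x h.symm.le, h0 x h.symm, smul_zero, add_zero]
    · simp only [hw]; rw [indicator_of_notMem (by simpa using h), smul_zero, add_zero]
  refine ⟨fun x hx => ?_, fun x hx y hy hxy => ?_, fun y hy => ?_⟩
  · have hx' : ‖x‖ < 1 := by simpa using hx
    have h1 := hmaps x hx'.le
    simp only [mem_ball, dist_zero_right]
    refine lt_of_le_of_ne h1 fun h2 => ?_
    have h3 := hbij.1 (a₁ := x + t • v x) (a₂ := x) (by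
      simp only; rw [hout _ h2.ge, hin x hx'.le])
    rw [h3] at h2
    exact hx'.ne h2
  · refine hbij.1 ?_
    simp only
    rw [hin x (by simpa using (mem_ball_zero_iff.1 hx).le),
      hin y (by simpa using (mem_ball_zero_iff.1 hy).le)]
    exact hxy
  · obtain ⟨x, hx⟩ := hbij.2 y
    have hy' : ‖y‖ < 1 := by simpa using hy
    simp only at hx
    have hx1 : ‖x‖ < 1 := by
      by_contra hcon
      rw [hout x (not_lt.1 hcon)] at hx
      exact hcon (hx ▸ hy')
    exact ⟨x, by simpa using hx1, by simpa [← hin x hx1.le] using hx⟩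

open Metric Set Topology in
/-- A linear map whose values are all orthogonal to a fixed nonzero vector has zero determinant. -/
theorem ContinuousLinearMap.det_eq_zero_of_inner_eq_zero {E : Type*} [NormedAddCommGroup E]
    [InnerProductSpace ℝ E] [FiniteDimensional ℝ E] {A : E →L[ℝ] E} {y : E} (hy : y ≠ 0)
    (h : ∀ v, inner ℝ y (A v) = 0) : A.det = 0 := by
  by_contra hdet
  have hdet' : IsUnit (LinearMap.det (A : E →ₗ[ℝ] E)) := isUnit_iff_ne_zero.2 hdet
  obtain ⟨v, hv⟩ := ((Module.End.isUnit_iff _).1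
    ((LinearMap.isUnit_iff_isUnit_det _).2 hdet')).surjective y
  have hv' : A v = y := hv
  have := h v
  rw [hv'] at this
  exact hy (inner_self_eq_zero.1 this)

open Metric Set Topology MeasureTheory Filter in
/-- There is no continuously differentiable retraction of the closed ball onto the sphere. -/
theorem not_exists_contDiffOn_retraction {E : Type*} [NormedAddCommGroup E]
    [InnerProductSpace ℝ E] [FiniteDimensional ℝ E] {r : E → E} {U : Set E} (hU : IsOpen U)
    (hsub : closedBall 0 1 ⊆ U) (hr : ContDiffOn ℝ 1 r U) (hid : ∀ x, ‖x‖ = 1 → r x = x) :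
    ¬ ∀ x, ‖x‖ ≤ 1 → ‖r x‖ = 1 := by
  intro hnorm
  let mE : MeasurableSpace E := borel E
  have bE : BorelSpace E := ⟨rfl⟩
  let μ : Measure E := Measure.addHaar
  have hprop : ProperSpace E := FiniteDimensional.proper ℝ E
  set D : E → E →L[ℝ] E := fun x => fderiv ℝ r x - ContinuousLinearMap.id ℝ E with hD
  have hcompact : IsCompact (closedBall (0 : E) 1) := isCompact_closedBall 0 1
  have hDcont : ContinuousOn D (closedBall 0 1) :=
    ((hr.continuousOn_fderiv_of_isOpen hU le_rfl).mono hsub).sub continuousOn_const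
  obtain ⟨C, hC⟩ := hcompact.exists_bound_of_continuousOn hDcont
  have hderiv : ∀ x ∈ closedBall (0 : E) 1, HasFDerivAt (fun x => r x - x) (D x) x := fun x hx =>
    (((hr.differentiableOn one_ne_zero).differentiableAt
      (hU.mem_nhds (hsub hx))).hasFDerivAt).sub (hasFDerivAt_id x)
  have hC0 : 0 ≤ C := (norm_nonneg _).trans (hC 0 (by simp))
  have hlip : LipschitzOnWith C.toNNReal (fun x => r x - x) (closedBall 0 1) := by
    refine (convex_closedBall (0 : E) 1).lipschitzOnWith_of_nnnorm_hasFDerivWithin_le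
      (fun x hx => (hderiv x hx).hasFDerivWithinAt) fun x hx => ?_
    rw [← NNReal.coe_le_coe, Real.coe_toNNReal C hC0]
    exact hC x hx
  have hdetcont : Continuous fun A : E →L[ℝ] E => A.det := ContinuousLinearMap.continuous_det
  have hdet1 : (ContinuousLinearMap.id ℝ E).det = 1 := LinearMap.det_id
  obtain ⟨η, hη, hpos⟩ : ∃ η > 0, ∀ A : E →L[ℝ] E, ‖A‖ < η →
      0 < (ContinuousLinearMap.id ℝ E + A).det := by
    have h1 : ∀ᶠ A : E →L[ℝ] E in 𝓝 0, 0 < (ContinuousLinearMap.id ℝ E + A).det := by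
      have h2 : Continuous fun A : E →L[ℝ] E => (ContinuousLinearMap.id ℝ E + A).det :=
        hdetcont.comp (continuous_const.add continuous_id)
      refine h2.continuousAt.eventually_const_lt ?_
      simp only [add_zero, hdet1]
      exact one_pos
    obtain ⟨η, hη, h3⟩ := Metric.eventually_nhds_iff.1 h1
    exact ⟨η, hη, fun A hA => h3 (by simpa using hA)⟩
  have hintt : ∀ t : ℝ, Integrable (fun x => (ContinuousLinearMap.id ℝ E + t • D x).det)
      (μ.restrict (ball 0 1)) := fun t =>
    IntegrableOn.mono_set (ContinuousOn.integrableOn_compact hcompact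
      (hdetcont.comp_continuousOn (continuousOn_const.add (hDcont.const_smul t))))
      ball_subset_closedBall
  -- The bounds on `t` make `x + t (r x - x)` a convex combination, the perturbation a contraction
  -- (`t C < 1`), and the determinant positive (`t C < η`); `C + 1` avoids dividing by zero.
  have hsmall : ∀ t ∈ Ioo 0 (min 1 (min 1 η / (C + 1))),
      ∫ x in ball 0 1, (ContinuousLinearMap.id ℝ E + t • D x).det ∂μ = μ.real (ball 0 1) := by
    rintro t ⟨ht0, ht⟩
    have ht1 : t < 1 := ht.trans_le (min_le_left _ _)
    have ht2 : t * (C + 1) < min 1 η :=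
      (lt_div_iff₀ (by linarith)).1 (ht.trans_le (min_le_right _ _))
    have ht3 : t * C < 1 := by nlinarith [min_le_left 1 η]
    have ht4 : t * C < η := by nlinarith [min_le_right 1 η]
    have hbij := hlip.bijOn_ball_add_smul (fun x hx => by rw [hid x hx, sub_self]) ht0.le
      (by rwa [Real.coe_toNNReal C hC0]) (fun x hx => by
        have : x + t • (r x - x) = (1 - t) • x + t • r x := by module
        rw [this]
        refine (norm_add_le _ _).trans ?_
        rw [norm_smul, norm_smul, hnorm x hx, Real.norm_of_nonneg ht0.le,
          Real.norm_of_nonneg (by linarith)]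
        nlinarith)
    have hcov := integral_image_eq_integral_abs_det_fderiv_smul μ (s := ball (0 : E) 1)
      (f := fun x => x + t • (r x - x)) (f' := fun x => ContinuousLinearMap.id ℝ E + t • D x)
      measurableSet_ball
      (fun x hx => ((hasFDerivAt_id x).add
        ((hderiv x (ball_subset_closedBall hx)).const_smul t)).hasFDerivWithinAt)
      hbij.injOn (fun _ => (1 : ℝ))
    rw [hbij.image_eq] at hcov
    simp only [smul_eq_mul, mul_one] at hcov
    have hint1 : ∫ _ in ball (0 : E) 1, (1 : ℝ) ∂μ = μ.real (ball 0 1) := by simp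
    rw [← hint1, hcov]
    refine setIntegral_congr_fun measurableSet_ball fun x hx => ?_
    refine (abs_of_pos (hpos _ ?_)).symm
    rw [norm_smul, Real.norm_of_nonneg ht0.le]
    exact (mul_le_mul_of_nonneg_left (hC x (ball_subset_closedBall hx)) ht0.le).trans_lt ht4
  have hone := integral_det_one_add_eq_of_forall_small D
    (lt_min one_pos (div_pos (lt_min one_pos hη) (by linarith))) hintt hsmall
  -- Differentiating `‖r‖² = 1` shows that the range of the derivative is orthogonal to `r x`.
  have hzero : ∫ x in ball 0 1, (ContinuousLinearMap.id ℝ E + D x).det ∂μ = 0 := by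
    refine setIntegral_eq_zero_of_forall_eq_zero fun x hx => ?_
    have hx1 : ‖x‖ < 1 := by simpa using hx
    have hrx : r x ≠ 0 := by
      rw [← norm_ne_zero_iff, hnorm x hx1.le]; exact one_ne_zero
    have h1 : ContinuousLinearMap.id ℝ E + D x = fderiv ℝ r x := by simp [hD]
    rw [h1]
    refine ContinuousLinearMap.det_eq_zero_of_inner_eq_zero hrx fun v => ?_
    have hrd : HasFDerivAt r (fderiv ℝ r x) x := ((hr.differentiableOn one_ne_zero).differentiableAt
      (hU.mem_nhds (hsub (ball_subset_closedBall hx)))).hasFDerivAt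
    have h2 := hrd.norm_sq
    have h3 : HasFDerivAt (fun y => ‖r y‖ ^ 2) (0 : E →L[ℝ] ℝ) x := by
      refine (hasFDerivAt_const (1 : ℝ) x).congr_of_eventuallyEq ?_
      filter_upwards [isOpen_ball.mem_nhds hx] with y hy
      rw [hnorm y (by simpa using (mem_ball_zero_iff.1 hy).le), one_pow]
    have h4 := congrArg (fun A : E →L[ℝ] ℝ => A v) (h2.unique h3)
    simpa using h4
  rw [hzero] at hone
  have : 0 < μ.real (ball (0 : E) 1) :=
    ENNReal.toReal_pos (measure_ball_pos μ 0 one_pos).ne' measure_ball_lt_top.ne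
  exact this.ne hone

/-! ### Brouwer's theorem: smooth, continuous, arbitrary norm -/

open Metric Set in
/-- Brouwer's theorem for a continuously differentiable map into the open Euclidean ball. -/
theorem exists_fixedPoint_of_contDiff {E : Type*} [NormedAddCommGroup E]
    [InnerProductSpace ℝ E] [FiniteDimensional ℝ E] {T : E → E} (hT : ContDiff ℝ 1 T)
    (hmaps : ∀ x, ‖x‖ ≤ 1 → ‖T x‖ < 1) : ∃ x, ‖x‖ ≤ 1 ∧ T x = x := by
  by_contra! hne
  -- `r x` is where the ray from `T x` through `x` leaves the sphere: `(√d - b) / a` is the larger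
  -- root `s` of `a s² + 2 b s + ‖x‖² - 1 = 0`.
  set a : E → ℝ := fun x => ‖x - T x‖ ^ 2 with ha
  set b : E → ℝ := fun x => inner ℝ x (x - T x) with hb
  set d : E → ℝ := fun x => b x ^ 2 + a x * (1 - ‖x‖ ^ 2) with hd
  set r : E → E := fun x => x + ((√(d x) - b x) / a x) • (x - T x) with hr
  have hdiff : ContDiff ℝ 1 fun x => x - T x := contDiff_id.sub hT
  have hac : ContDiff ℝ 1 a := hdiff.norm_sq ℝ
  have hbc : ContDiff ℝ 1 b := contDiff_id.inner ℝ hdiff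
  have hdc : ContDiff ℝ 1 d :=
    (hbc.pow 2).add (hac.mul (contDiff_const.sub (contDiff_id.norm_sq ℝ)))
  have hapos : ∀ x, ‖x‖ ≤ 1 → 0 < a x := fun x hx => by
    have : 0 < ‖x - T x‖ := norm_pos_iff.2 (sub_ne_zero.2 (hne x hx).symm)
    positivity
  -- The strict bound on `T` enters here; it keeps `d` positive up to the sphere, so that the square
  -- root is smooth, and makes the root 0 there.
  have hbpos : ∀ x, ‖x‖ = 1 → 0 < b x := fun x hx => by
    have h1 : b x = ‖x‖ ^ 2 - inner ℝ x (T x) := by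
      simp only [hb]; rw [inner_sub_right, real_inner_self_eq_norm_sq]
    have h2 := real_inner_le_norm x (T x)
    have h3 := hmaps x hx.le
    rw [hx] at h1 h2
    linarith
  have hdpos : ∀ x, ‖x‖ ≤ 1 → 0 < d x := fun x hx => by
    rcases hx.eq_or_lt with h | h
    · have := hbpos x h
      simp only [hd]; rw [h]; simp only [one_pow, sub_self, mul_zero, add_zero]; positivity
    · have h1 := hapos x hx
      have h2 : 0 < 1 - ‖x‖ ^ 2 := by nlinarith [norm_nonneg x]
      simp only [hd]; positivity
  refine not_exists_contDiffOn_retraction (r := r) (U := {x | a x ≠ 0} ∩ {x | d x ≠ 0})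
    ((isOpen_ne_fun hac.continuous continuous_const).inter
      (isOpen_ne_fun hdc.continuous continuous_const))
    (fun x hx => ⟨(hapos x (by simpa using hx)).ne', (hdpos x (by simpa using hx)).ne'⟩)
    ?_ (fun x hx => ?_) fun x hx => ?_
  · refine contDiff_id.contDiffOn.add (ContDiffOn.smul (ContDiffOn.div
      ((hdc.contDiffOn.sqrt fun x hx => hx.2).sub hbc.contDiffOn) hac.contDiffOn fun x hx => hx.1)
      hdiff.contDiffOn)
  · have h1 : d x = b x ^ 2 := by simp [hd, hx]
    simp only [hr]
    rw [h1, Real.sqrt_sq (hbpos x hx).le, sub_self, zero_div, zero_smul, add_zero]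
  · have hax := hapos x hx
    have h1 : ‖r x‖ ^ 2 = 1 := by
      simp only [hr]
      rw [norm_add_sq_real, norm_smul, inner_smul_right, mul_pow, Real.norm_eq_abs, sq_abs]
      have h2 := Real.sq_sqrt (hdpos x hx).le
      change ‖x‖ ^ 2 + 2 * ((√(d x) - b x) / a x * b x) + ((√(d x) - b x) / a x) ^ 2 * a x = 1
      field_simp
      have h3 : d x = b x ^ 2 + a x * (1 - ‖x‖ ^ 2) := rfl
      rw [h3] at h2
      set q := √(d x)
      nlinarith
    nlinarith [norm_nonneg (r x), sq_nonneg (‖r x‖ - 1)]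

open Metric Set in
/-- Brouwer's theorem for the Euclidean unit ball. -/
theorem exists_fixedPoint_of_continuous_euclidean {E : Type*} [NormedAddCommGroup E]
    [InnerProductSpace ℝ E] [FiniteDimensional ℝ E] {T : E → E} (hT : Continuous T)
    (hmaps : ∀ x, ‖x‖ ≤ 1 → ‖T x‖ ≤ 1) : ∃ x, ‖x‖ ≤ 1 ∧ T x = x := by
  by_contra! hne
  have hprop : ProperSpace E := FiniteDimensional.proper ℝ E
  obtain ⟨x₀, hx₀, hmin⟩ := (isCompact_closedBall (0 : E) 1).exists_isMinOn
    ⟨0, by simp⟩ (hT.sub continuous_id).norm.continuousOn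
  have hm : 0 < ‖T x₀ - x₀‖ :=
    norm_pos_iff.2 (sub_ne_zero.2 (hne x₀ (by simpa using hx₀)))
  -- A fixed point of the rescaled approximation is moved by `T` by at most `2 ε`, below the minimal
  -- displacement `3 ε`.
  set ε : ℝ := ‖T x₀ - x₀‖ / 3 with hε
  have hε0 : 0 < ε := by positivity
  obtain ⟨G, hG, happ, -⟩ := hT.exists_contDiff_approx 1 (continuous_const (y := ε)) fun _ => hε0
  have hGn : ∀ x, ‖x‖ ≤ 1 → ‖G x‖ < 1 + ε := fun x hx => by
    have h1 := happ x
    rw [dist_eq_norm] at h1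
    have h2 := norm_add_le (G x - T x) (T x)
    rw [sub_add_cancel] at h2
    linarith [hmaps x hx]
  obtain ⟨x, hx, hfix⟩ := exists_fixedPoint_of_contDiff (T := fun x => (1 + ε)⁻¹ • G x)
    (contDiff_const.smul hG) fun x hx => by
      rw [norm_smul, norm_inv, Real.norm_of_nonneg (by linarith), inv_mul_lt_iff₀ (by linarith),
        mul_one]
      exact hGn x hx
  have hGx : G x = x + ε • x := by
    have h1 : (1 + ε) • ((1 + ε)⁻¹ • G x) = G x := smul_inv_smul₀ (by linarith) _
    rw [← h1, hfix, add_smul, one_smul]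
  have h1 : ‖T x₀ - x₀‖ ≤ ‖T x - x‖ := hmin (by simpa using hx)
  have h2 := happ x
  rw [dist_comm, dist_eq_norm] at h2
  have h3 : T x - x = (T x - G x) + ε • x := by rw [hGx]; abel
  have h4 := norm_add_le (T x - G x) (ε • x)
  rw [← h3, norm_smul, Real.norm_of_nonneg hε0.le] at h4
  nlinarith

open Metric Set in
/-- Brouwer's theorem for a ball of an arbitrary norm on a finite-dimensional space. -/
theorem exists_fixedPoint_of_mapsTo_closedBall {E : Type*} [NormedAddCommGroup E]
    [NormedSpace ℝ E] [FiniteDimensional ℝ E] {T : E → E} (hT : Continuous T) {r : ℝ} (hr : 0 < r)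
    (hmaps : ∀ x, ‖x‖ ≤ r → ‖T x‖ ≤ r) : ∃ x, ‖x‖ ≤ r ∧ T x = x := by
  have hprop : ProperSpace E := FiniteDimensional.proper ℝ E
  set φ := toEuclidean (E := E)
  -- Radial retraction to the ball. A fixed point of `T ∘ ρ` lies in the ball, hence is fixed by `ρ`
  -- and by `T`; this map has bounded range, so it can be conjugated and rescaled into the Euclidean
  -- unit ball.
  set ρ : E → E := fun x => (r / max r ‖x‖) • x with hρ
  have hmax : ∀ x : E, 0 < max r ‖x‖ := fun x => lt_max_of_lt_left hr
  have hρc : Continuous ρ :=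
    (continuous_const.div (continuous_const.max continuous_norm) fun x => (hmax x).ne').smul
      continuous_id
  have hρn : ∀ x, ‖ρ x‖ ≤ r := fun x => by
    simp only [hρ]
    rw [norm_smul, Real.norm_of_nonneg (div_nonneg hr.le (hmax x).le), div_mul_eq_mul_div,
      div_le_iff₀ (hmax x)]
    exact mul_le_mul_of_nonneg_left (le_max_right _ _) hr.le
  have hρid : ∀ x, ‖x‖ ≤ r → ρ x = x := fun x hx => by
    simp only [hρ]
    rw [max_eq_left hx, div_self hr.ne', one_smul]
  obtain ⟨C, hC⟩ := (isCompact_closedBall (0 : E) r).exists_bound_of_continuousOn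
    φ.continuous.continuousOn
  set R := max C 1
  have hR : 0 < R := lt_max_of_lt_right one_pos
  obtain ⟨y, -, hy⟩ := exists_fixedPoint_of_continuous_euclidean
    (T := fun y => R⁻¹ • φ (T (ρ (φ.symm (R • y)))))
    (by fun_prop) fun y _ => by
      rw [norm_smul, norm_inv, Real.norm_of_nonneg hR.le, inv_mul_le_iff₀ hR, mul_one]
      exact (hC _ (by simpa using hmaps _ (hρn _))).trans (le_max_left _ _)
  set x := φ.symm (R • y) with hx
  have h1 : T (ρ x) = x := by
    apply φ.injective
    rw [hx, φ.apply_symm_apply, ← hx]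
    exact (inv_smul_eq_iff₀ hR.ne').1 hy
  have h2 : ‖x‖ ≤ r := h1 ▸ hmaps _ (hρn x)
  exact ⟨x, h2, by rwa [hρid x h2] at h1⟩

/-! ### Convexity of suprema and the scalar condition -/

/-- The supremum over the unit ball of the norm of an affine function of a parameter,
if attained, is convex in the parameter. -/
theorem convexOn_of_isGreatest_norm {P E F : Type*} [AddCommGroup P] [Module ℝ P]
    [NormedAddCommGroup F] [NormedSpace ℝ F] {s : Set E} {m : P → ℝ} (A : E → P →ᵃ[ℝ] F)
    (hm : ∀ u, IsGreatest ((fun y => ‖A y u‖) '' s) (m u)) : ConvexOn ℝ Set.univ m := by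
  refine ⟨convex_univ, fun u _ v _ a b ha hb hab => ?_⟩
  -- The maximiser at the combined parameter is a competitor at both endpoints.
  obtain ⟨y, hy, hyv⟩ := (hm (a • u + b • v)).1
  have h1 : A y (a • u + b • v) = a • A y u + b • A y v :=
    Convex.combo_affine_apply hab
  have h2 : ‖A y u‖ ≤ m u := (hm u).2 ⟨y, hy, rfl⟩
  have h3 : ‖A y v‖ ≤ m v := (hm v).2 ⟨y, hy, rfl⟩
  simp only at hyv
  rw [← hyv, h1, smul_eq_mul, smul_eq_mul]
  refine (norm_add_le _ _).trans ?_
  rw [norm_smul, norm_smul, Real.norm_of_nonneg ha, Real.norm_of_nonneg hb]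
  gcongr

/-- The quadratic condition `s h + g + e / s ≤ 1` is solvable in `s > 0` exactly when
`2 √(h e) + g ≤ 1`, apart from the cases where the infimum over `s` is not attained. -/
theorem exists_pos_mul_add_add_div_le_one_iff {h g e : ℝ} (hh : 0 ≤ h) (he : 0 ≤ e) :
    (∃ s > 0, s * h + g + 1 / s * e ≤ 1) ↔
      2 * √(h * e) + g ≤ 1 ∧ ¬ (g = 1 ∧ ((h = 0 ∧ e ≠ 0) ∨ (h ≠ 0 ∧ e = 0))) := by
  constructor
  · rintro ⟨s, hs, hle⟩
    refine ⟨?_, ?_⟩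
    -- AM-GM: the product of `s h` and `e / s` does not depend on `s`.
    · have h1 : √(h * e) = √(s * h) * √(1 / s * e) := by
        rw [← Real.sqrt_mul (by positivity)]
        congr 1
        field_simp
      have h2 := Real.sq_sqrt (mul_nonneg hs.le hh)
      have h3 := Real.sq_sqrt (mul_nonneg (one_div_pos.2 hs).le he)
      rw [h1]
      nlinarith [sq_nonneg (√(s * h) - √(1 / s * e))]
    · rintro ⟨hg, ⟨h0, e0⟩ | ⟨h0, e0⟩⟩
      · have : 0 < 1 / s * e := mul_pos (one_div_pos.2 hs) (he.lt_of_ne' e0)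
        rw [h0] at hle
        linarith
      · have : 0 < s * h := mul_pos hs (hh.lt_of_ne' h0)
        rw [e0] at hle
        linarith
  · rintro ⟨hle, hex⟩
    -- The minimiser `√e / √h` needs both positive. If exactly one vanishes, `s` solves the
    -- condition with equality, which requires the `g < 1` supplied by the exclusion.
    rcases hh.eq_or_lt with h0 | h0 <;> rcases he.eq_or_lt with e0 | e0
    · refine ⟨1, one_pos, ?_⟩
      subst h0
      subst e0
      simpa using hle
    · have hg : g < 1 := by
        have h1 : g ≤ 1 := by rw [← h0] at hle; simpa using hle
        exact h1.lt_of_ne fun h2 => hex ⟨h2, Or.inl ⟨h0.symm, e0.ne'⟩⟩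
      have h1 : 0 < 1 - g := by linarith
      refine ⟨e / (1 - g), by positivity, ?_⟩
      rw [← h0]
      field_simp
      linarith
    · have hg : g < 1 := by
        have h1 : g ≤ 1 := by rw [← e0] at hle; simpa using hle
        exact h1.lt_of_ne fun h2 => hex ⟨h2, Or.inr ⟨h0.ne', e0.symm⟩⟩
      have h1 : 0 < 1 - g := by linarith
      refine ⟨(1 - g) / h, by positivity, ?_⟩
      rw [← e0]
      field_simp
      linarith
    · refine ⟨√e / √h, by positivity, ?_⟩
      have hh' : 0 < √h := Real.sqrt_pos.2 h0
      have he' : 0 < √e := Real.sqrt_pos.2 e0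
      have h1 : √e / √h * h = √(h * e) := by
        rw [Real.sqrt_mul hh]
        field_simp
        rw [Real.sq_sqrt hh]
      have h2 : 1 / (√e / √h) * e = √(h * e) := by
        rw [Real.sqrt_mul hh]
        field_simp
        rw [Real.sq_sqrt he]
      rw [h1, h2]
      linarith

/-! ### The certificate for quadratic systems -/

namespace QuadSystem

variable {E P : Type*} [NormedAddCommGroup E] [NormedSpace ℝ E]
  [NormedAddCommGroup P] [NormedSpace ℝ P]

theorem f_add (S : QuadSystem E P) (x d : E) (u : P) :
    S.f (x + d) u = S.f x u + S.jac x u d + S.Q u d d := by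
  simp only [f, jac, map_add, LinearMap.add_apply, LinearMap.flip_apply]
  abel

theorem jacInv_jac (S : QuadSystem E P) {xs : E} {us : P} (hJ : IsUnit (S.jac xs us)) (y : E) :
    S.jacInv xs us (S.jac xs us y) = y :=
  LinearMap.congr_fun (Ring.inverse_mul_cancel _ hJ) y

theorem jacInv_injective (S : QuadSystem E P) {xs : E} {us : P} (hJ : IsUnit (S.jac xs us)) :
    Function.Injective (S.jacInv xs us) :=
  Function.LeftInverse.injective (g := S.jac xs us) fun y =>
    LinearMap.congr_fun (Ring.mul_inverse_cancel _ hJ) y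

theorem e_nonneg (S : QuadSystem E P) (xs : E) (us u : P) : 0 ≤ S.e xs us u := norm_nonneg _

theorem h_nonneg [FiniteDimensional ℝ E] (S : QuadSystem E P) (xs : E) (us u : P) :
    0 ≤ S.h xs us u :=
  (norm_nonneg _).trans ((S.h_isGreatest xs us u).2 ⟨0, by simp, rfl⟩)

theorem norm_jacInv_Q_le [FiniteDimensional ℝ E] (S : QuadSystem E P) (xs : E) (us u : P)
    (y : E) : ‖S.jacInv xs us (S.Q u y y)‖ ≤ S.h xs us u * ‖y‖ ^ 2 := by
  rcases eq_or_ne y 0 with rfl | hy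
  · simp
  · have hy' : 0 < ‖y‖ := norm_pos_iff.2 hy
    have h1 := (S.h_isGreatest xs us u).2 ⟨‖y‖⁻¹ • y, by simp [norm_smul, hy'.ne'], rfl⟩
    simp only [map_smul, LinearMap.smul_apply, norm_smul, norm_inv, norm_norm] at h1
    rw [← mul_assoc, ← mul_inv, ← sq, inv_mul_le_iff₀ (by positivity)] at h1
    linarith

theorem norm_jacInv_jac_sub_le [FiniteDimensional ℝ E] (S : QuadSystem E P) (xs : E) (us u : P)
    (y : E) : ‖S.jacInv xs us (S.jac xs u y) - y‖ ≤ S.g xs us u * ‖y‖ := by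
  rcases eq_or_ne y 0 with rfl | hy
  · simp
  · have hy' : 0 < ‖y‖ := norm_pos_iff.2 hy
    have h1 := (S.g_isGreatest xs us u).2 ⟨‖y‖⁻¹ • y, by simp [norm_smul, hy'.ne'], rfl⟩
    simp only [map_smul] at h1
    rw [← smul_sub, norm_smul, norm_inv, norm_norm, inv_mul_le_iff₀ hy'] at h1
    linarith

theorem continuous_f [FiniteDimensional ℝ E] (S : QuadSystem E P) (u : P) :
    Continuous fun x => S.f x u :=
  continuous_iff_continuousAt.2 fun x => (S.hasFDerivAt_f x u).continuousAt

/-- The Jacobian at a fixed `x`, as an affine function of the parameter. -/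
noncomputable def jacAffine (S : QuadSystem E P) (x : E) : P →ᵃ[ℝ] Module.End ℝ E :=
  (LinearMap.applyₗ x).toAffineMap.comp S.Q
    + ((LinearMap.applyₗ x).comp (LinearMap.lflip (R₀ := ℝ)).toLinearMap).toAffineMap.comp S.Q + S.L

theorem convexOn_h [FiniteDimensional ℝ E] (S : QuadSystem E P) (xs : E) (us : P) :
    ConvexOn ℝ Set.univ (S.h xs us) :=
  convexOn_of_isGreatest_norm (fun y =>
    ((S.jacInv xs us) ∘ₗ (LinearMap.applyₗ y) ∘ₗ (LinearMap.applyₗ y)).toAffineMap.comp S.Q)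
    (S.h_isGreatest xs us)

theorem convexOn_g [FiniteDimensional ℝ E] (S : QuadSystem E P) (xs : E) (us : P) :
    ConvexOn ℝ Set.univ (S.g xs us) :=
  convexOn_of_isGreatest_norm (fun y =>
    ((S.jacInv xs us) ∘ₗ (LinearMap.applyₗ y)).toAffineMap.comp (S.jacAffine xs)
      - AffineMap.const ℝ P y)
    (S.g_isGreatest xs us)

theorem convexOn_e (S : QuadSystem E P) (xs : E) (us : P) :
    ConvexOn ℝ Set.univ (S.e xs us) :=
  -- A one-point index set, since no supremum is taken in `e`.
  convexOn_of_isGreatest_norm (s := {()}) (fun _ => (S.jacInv xs us).toAffineMap.comp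
    (((LinearMap.applyₗ xs) ∘ₗ (LinearMap.applyₗ xs)).toAffineMap.comp S.Q
      + (LinearMap.applyₗ xs).toAffineMap.comp S.L + S.K - AffineMap.const ℝ P (S.f xs us)))
    fun u => by
      rw [Set.image_singleton]
      exact isGreatest_singleton

theorem e_self (S : QuadSystem E P) (xs : E) (us : P) : S.e xs us us = 0 := by simp [e]

theorem g_self [FiniteDimensional ℝ E] (S : QuadSystem E P) {xs : E} {us : P}
    (hJ : IsUnit (S.jac xs us)) : S.g xs us us = 0 := by
  obtain ⟨y, -, hy⟩ := (S.g_isGreatest xs us us).1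
  rw [← hy]
  simp [S.jacInv_jac hJ]

/-- Finite convex functions on a finite-dimensional space are locally Lipschitz. -/
theorem continuous_certificate [FiniteDimensional ℝ E] [FiniteDimensional ℝ P]
    (S : QuadSystem E P) (xs : E) (us : P) (a b : ℝ) :
    Continuous fun u => a * S.h xs us u + S.g xs us u + b * S.e xs us u :=
  (((S.convexOn_h xs us).locallyLipschitz.continuous.const_mul a).add
    (S.convexOn_g xs us).locallyLipschitz.continuous).add
      ((S.convexOn_e xs us).locallyLipschitz.continuous.const_mul b)

/-- The certificate for a single radius: a Newton-type map sends the ball into itself. -/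
theorem exists_solution_of_certificate [FiniteDimensional ℝ E] (S : QuadSystem E P) {xs : E}
    {us : P} (hsol : S.f xs us = 0) (hJ : IsUnit (S.jac xs us)) {r : ℝ} (hr : 0 < r) {u : P}
    (hu : r * S.h xs us u + S.g xs us u + 1 / r * S.e xs us u ≤ 1) :
    ∃ x : E, ‖x - xs‖ ≤ r ∧ S.f x u = 0 := by
  have hcont : Continuous fun d => d - S.jacInv xs us (S.f (xs + d) u) :=
    continuous_id.sub ((S.jacInv xs us).continuous_of_finiteDimensional.comp
      ((S.continuous_f u).comp (continuous_const.add continuous_id)))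
  obtain ⟨d, hd, hfix⟩ := exists_fixedPoint_of_mapsTo_closedBall hcont hr fun d hd => by
    -- The three summands are the quantities bounded by `e`, `g ‖d‖` and `h ‖d‖²`.
    have h1 : d - S.jacInv xs us (S.f (xs + d) u) =
        -(S.jacInv xs us (S.f xs u - S.f xs us) + (S.jacInv xs us (S.jac xs u d) - d)
          + S.jacInv xs us (S.Q u d d)) := by
      rw [S.f_add, hsol, sub_zero, map_add, map_add]
      abel
    rw [h1, norm_neg]
    refine (norm_add₃_le).trans ?_
    have h2 : ‖S.jacInv xs us (S.f xs u - S.f xs us)‖ = S.e xs us u := rfl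
    have h3 := S.norm_jacInv_jac_sub_le xs us u d
    have h4 := S.norm_jacInv_Q_le xs us u d
    have hg : 0 ≤ S.g xs us u :=
      (norm_nonneg _).trans ((S.g_isGreatest xs us u).2 ⟨0, by simp, rfl⟩)
    have h5 : S.g xs us u * ‖d‖ ≤ S.g xs us u * r := mul_le_mul_of_nonneg_left hd hg
    have h6 : S.h xs us u * ‖d‖ ^ 2 ≤ S.h xs us u * r ^ 2 :=
      mul_le_mul_of_nonneg_left (pow_le_pow_left₀ (norm_nonneg d) hd 2) (S.h_nonneg xs us u)
    have h7 : r * (r * S.h xs us u + S.g xs us u + 1 / r * S.e xs us u)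
        = S.h xs us u * r ^ 2 + S.g xs us u * r + S.e xs us u := by
      field_simp
    have h8 := mul_le_mul_of_nonneg_left hu hr.le
    rw [h7] at h8
    linarith
  refine ⟨xs + d, by simpa using hd, S.jacInv_injective hJ ?_⟩
  rw [map_zero]
  simpa using hfix

theorem convex_certSet [FiniteDimensional ℝ E] (S : QuadSystem E P) (xs : E) (us : P) {r δ : ℝ}
    (hrδ : 0 ≤ r * δ) : Convex ℝ (S.certSet xs us r δ) := by
  have h1 := ((((S.convexOn_h xs us).smul hrδ).add (S.convexOn_g xs us)).add
    ((S.convexOn_e xs us).smul (one_div_nonneg.2 hrδ))).convex_le 1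
  simpa [certSet] using h1

theorem mem_interior_certUnion [FiniteDimensional ℝ E] [FiniteDimensional ℝ P]
    (S : QuadSystem E P) {xs : E} {us : P} (hJ : IsUnit (S.jac xs us)) {r : ℝ} (hr : 0 < r) :
    us ∈ interior (S.certUnion xs us r) := by
  have hh := S.h_nonneg xs us us
  -- At `us` both `g` and `e` vanish, and this `δ` leaves `r h / (1 + r h) < 1`; the strict
  -- inequality persists nearby.
  set δ : ℝ := 1 / (1 + r * S.h xs us us) with hδ
  have hpos : 0 < 1 + r * S.h xs us us := by positivity
  have hδ0 : 0 < δ := by positivity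
  have hδ1 : δ ≤ 1 := by
    rw [hδ, div_le_one hpos]
    linarith [mul_nonneg hr.le hh]
  rw [mem_interior_iff_mem_nhds]
  have h1 : r * δ * S.h xs us us + S.g xs us us + 1 / (r * δ) * S.e xs us us < 1 := by
    rw [S.g_self hJ, S.e_self, mul_zero, add_zero, add_zero, hδ, mul_one_div, div_mul_eq_mul_div,
      div_lt_one hpos]
    linarith
  filter_upwards [(S.continuous_certificate xs us (r * δ) (1 / (r * δ))).continuousAt.eventually_lt
    continuousAt_const h1] with u hu
  exact Set.mem_biUnion (x := δ) ⟨hδ0, hδ1⟩ hu.le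

theorem mem_certUnion_iff (S : QuadSystem E P) {xs : E} {us u : P} {r : ℝ} :
    u ∈ S.certUnion xs us r ↔ ∃ δ ∈ Set.Ioc (0 : ℝ) 1,
      r * δ * S.h xs us u + S.g xs us u + 1 / (r * δ) * S.e xs us u ≤ 1 := by
  simp [certUnion, certSet]

theorem mem_iUnion_certUnion_iff [FiniteDimensional ℝ E] (S : QuadSystem E P) {xs : E}
    {us u : P} : u ∈ (⋃ r ∈ Set.Ioi (0 : ℝ), S.certUnion xs us r) ↔
      u ∈ S.certInf xs us ∧ ¬ (S.g xs us u = 1 ∧ ((S.h xs us u = 0 ∧ S.e xs us u ≠ 0) ∨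
        (S.h xs us u ≠ 0 ∧ S.e xs us u = 0))) := by
  have h1 := exists_pos_mul_add_add_div_le_one_iff (g := S.g xs us u) (S.h_nonneg xs us u)
    (S.e_nonneg xs us u)
  rw [certInf, Set.mem_ofPred_eq, ← h1]
  simp only [Set.mem_iUnion, mem_certUnion_iff, Set.mem_Ioi, exists_prop]
  constructor
  · rintro ⟨r, hr, δ, hδ, hle⟩
    exact ⟨r * δ, mul_pos hr hδ.1, hle⟩
  · rintro ⟨s, hs, hle⟩
    exact ⟨s, hs, 1, ⟨one_pos, le_rfl⟩, by rwa [mul_one]⟩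

end QuadSystem

theorem theorem2 {E P : Type*}
    [NormedAddCommGroup E] [NormedSpace ℝ E] [FiniteDimensional ℝ E]
    [NormedAddCommGroup P] [NormedSpace ℝ P] [FiniteDimensional ℝ P]
    (S : QuadSystem E P) (xs : E) (us : P)
    (hsol : S.f xs us = 0) (hJ : IsUnit (S.jac xs us)) :
    -- the certificate for a single radius
    (∀ r : ℝ, 0 < r → ∀ u : P,
      r * S.h xs us u + S.g xs us u + 1 / r * S.e xs us u ≤ 1 →
        ∃ x : E, ‖x - xs‖ ≤ r ∧ S.f x u = 0) ∧
    -- every parameter in `U_r` has a solution within distance `r` of `x⋆`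
    (∀ r : ℝ, 0 < r → ∀ u ∈ S.certUnion xs us r, ∃ x : E, ‖x - xs‖ ≤ r ∧ S.f x u = 0) ∧
    -- each `U_r(δ)` is convex
    (∀ r : ℝ, 0 < r → ∀ δ ∈ Set.Ioc (0 : ℝ) 1, Convex ℝ (S.certSet xs us r δ)) ∧
    -- `u⋆` is an interior point of `U_r`
    (∀ r : ℝ, 0 < r → us ∈ interior (S.certUnion xs us r)) ∧
    -- the union of the `U_r`, `r > 0`, is `U_∞` without the degenerate points at which `g = 1` and
    -- exactly one of `h`, `e` vanishes (there the minimum over the radius is not attained)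
    (⋃ r ∈ Set.Ioi (0 : ℝ), S.certUnion xs us r) =
      S.certInf xs us \
        {u | S.g xs us u = 1 ∧ ((S.h xs us u = 0 ∧ S.e xs us u ≠ 0) ∨
          (S.h xs us u ≠ 0 ∧ S.e xs us u = 0))} ∧
    -- with `r = 0` admitted under the convention `0 / 0 = 0` (and `c / 0 = ∞` for `c > 0`), the only
    -- missing points are those with `g = 1`, `h = 0`, `e ≠ 0`
    (⋃ r ∈ Set.Ioi (0 : ℝ), S.certUnion xs us r) ∪
        {u | S.e xs us u = 0 ∧ S.g xs us u ≤ 1} =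
      S.certInf xs us \ {u | S.g xs us u = 1 ∧ S.h xs us u = 0 ∧ S.e xs us u ≠ 0} ∧
    -- solvability on `U_∞`
    (∀ u ∈ S.certInf xs us,
      ¬ (S.g xs us u = 1 ∧ S.h xs us u = 0 ∧ S.e xs us u ≠ 0) → ∃ x : E, S.f x u = 0) := by
  have hunion : ∀ r : ℝ, 0 < r → ∀ u ∈ S.certUnion xs us r, ∃ x : E, ‖x - xs‖ ≤ r ∧ S.f x u = 0 := by
    intro r hr u hu
    obtain ⟨δ, hδ, hle⟩ := S.mem_certUnion_iff.1 hu
    obtain ⟨x, hx, hfx⟩ := S.exists_solution_of_certificate hsol hJ (mul_pos hr hδ.1) hle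
    exact ⟨x, hx.trans (mul_le_of_le_one_right hr.le hδ.2), hfx⟩
  have hzero : (⋃ r ∈ Set.Ioi (0 : ℝ), S.certUnion xs us r) ∪
        {u | S.e xs us u = 0 ∧ S.g xs us u ≤ 1} =
      S.certInf xs us \ {u | S.g xs us u = 1 ∧ S.h xs us u = 0 ∧ S.e xs us u ≠ 0} := by
    ext u
    rw [Set.mem_union, S.mem_iUnion_certUnion_iff, Set.mem_sdiff]
    have h1 : S.e xs us u = 0 → (u ∈ S.certInf xs us ↔ S.g xs us u ≤ 1) := fun h => by
      simp [QuadSystem.certInf, h]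
    simp only [Set.mem_ofPred_eq]
    tauto
  refine ⟨fun r hr u hu => S.exists_solution_of_certificate hsol hJ hr hu, hunion,
    fun r hr δ hδ => S.convex_certSet xs us (mul_pos hr hδ.1).le,
    fun r hr => S.mem_interior_certUnion hJ hr, ?_, hzero, fun u hu hex => ?_⟩
  · ext u
    rw [S.mem_iUnion_certUnion_iff]
    rfl
  · have hmem : u ∈ S.certInf xs us \
        {u | S.g xs us u = 1 ∧ S.h xs us u = 0 ∧ S.e xs us u ≠ 0} := ⟨hu, hex⟩
    rw [← hzero] at hmem
    rcases hmem with hmem | ⟨he, -⟩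
    · simp only [Set.mem_iUnion, exists_prop] at hmem
      obtain ⟨r, hr, hur⟩ := hmem
      obtain ⟨x, -, hx⟩ := hunion r hr u hur
      exact ⟨x, hx⟩
    -- Radius zero: `e = 0` means that `xs` itself solves the system at `u`.
    · refine ⟨xs, S.jacInv_injective hJ ?_⟩
      rw [map_zero]
      simpa [QuadSystem.e, hsol] using he
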